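/- Let $p>1$ and let $N>1$ be an integer. Let $f\colon\mathbb R\to\mathbb R$ be a continuous function and let $\alpha\le\beta$ be real numbers such that $f$ is positive and non-increasing on $(-\infty,\alpha)$, and negative and non-increasing on $(\beta,+\infty)$. Suppose that, for some $a\le\alpha$ and some $b\ge\beta$ (for instance $a=\alpha$ and $b=\beta$), $$\int_{-\infty}^{a}\left(\int_t^{a} f(s)\,ds\right)^{-1/p}dt<+\infty,\qquad \int_{b}^{+\infty}\left(\int_b^{t} -f(s)\,ds\right)^{-1/p}dt<+\infty .$$ Let $u$ be a solution of $$-\operatorname{div}\left(|\nabla u|^{p-2}\nabla u\right)=f(u)\quad\text{on }\mathbb R^N ,$$ that is, $u\in C^1(\mathbb R^N)$ and for every nonnegative $\phi\in C^1(\mathbb R^N)$ with compact support $$\int_{\mathbb R^N}|\nabla u|^{p-2}\nabla u\cdot\nabla\phi\,dx=\int_{\mathbb R^N}f(u)\,\phi\,dx .$$ Then $u$ is bounded and $\alpha\le u(x)\le\beta$ for every $x\in\mathbb R^N$. -/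

import Mathlib

open MeasureTheory Set
open scoped ENNReal RealInnerProductSpace

noncomputable section

/-- The vector field `|∇u|^{p-2} ∇u`. For `p > 1` it is extended by `0` at the zeros of `∇u`. -/
def pFlux {N : ℕ} (p : ℝ) (u : EuclideanSpace ℝ (Fin N) → ℝ) (x : EuclideanSpace ℝ (Fin N)) :
    EuclideanSpace ℝ (Fin N) :=
  ‖gradient u x‖ ^ (p - 2) • gradient u x

/-- `u` is a (weak `C¹`) solution of `-div(|∇u|^{p-2} ∇u) ≥ h` on `ℝ^N`: the inequality is tested
against all nonnegative `C¹` functions with compact support. -/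
def IsPSupersolution {N : ℕ} (p : ℝ) (h u : EuclideanSpace ℝ (Fin N) → ℝ) : Prop :=
  ContDiff ℝ 1 u ∧
    ∀ φ : EuclideanSpace ℝ (Fin N) → ℝ, ContDiff ℝ 1 φ → HasCompactSupport φ → (∀ x, 0 ≤ φ x) →
      ∫ x, h x * φ x ≤ ∫ x, ⟪pFlux p u x, gradient φ x⟫

/-- `u` is a (weak `C¹`) solution of `-div(|∇u|^{p-2} ∇u) ≤ h` on `ℝ^N`. -/
def IsPSubsolution {N : ℕ} (p : ℝ) (h u : EuclideanSpace ℝ (Fin N) → ℝ) : Prop :=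
  ContDiff ℝ 1 u ∧
    ∀ φ : EuclideanSpace ℝ (Fin N) → ℝ, ContDiff ℝ 1 φ → HasCompactSupport φ → (∀ x, 0 ≤ φ x) →
      ∫ x, ⟪pFlux p u x, gradient φ x⟫ ≤ ∫ x, h x * φ x

/-- `u` is a (weak `C¹`) solution of `-div(|∇u|^{p-2} ∇u) = f(u)` on `ℝ^N`: both differential
inequalities hold, with the right-hand side `h(x) = f(u(x))`. -/
def IsPSolution {N : ℕ} (p : ℝ) (f : ℝ → ℝ) (u : EuclideanSpace ℝ (Fin N) → ℝ) : Prop :=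
  IsPSupersolution p (fun x => f (u x)) u ∧ IsPSubsolution p (fun x => f (u x)) u

/-- The Keller–Osserman condition at `-∞` with base point `a`:
`∫_{-∞}^a (∫_t^a f(s) ds)^{-1/p} dt < +∞`. It is used only where `f > 0` on `(-∞, a)`, so that the
inner integral is positive for every `t < a`. -/
def KellerOssermanAtBot (p : ℝ) (f : ℝ → ℝ) (a : ℝ) : Prop :=
  ∫⁻ t in Iio a, ENNReal.ofReal ((∫ s in t..a, f s) ^ (-(1 / p))) < ⊤

/-- The Keller–Osserman condition at `+∞` with base point `b`:
`∫_b^{+∞} (∫_b^t -f(s) ds)^{-1/p} dt < +∞`. It is used only where `f < 0` on `(b, +∞)`, so that the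
inner integral is positive for every `t > b`. -/
def KellerOssermanAtTop (p : ℝ) (f : ℝ → ℝ) (b : ℝ) : Prop :=
  ∫⁻ t in Ioi b, ENNReal.ofReal ((∫ s in b..t, -f s) ^ (-(1 / p))) < ⊤

end

open Filter Topology

/-! The upper bound rests on a comparison with radial barriers; the lower bound follows by applying
it to `-u` and `t ↦ -f (-t)`. Fix `c > β` and a centre `x₀`. The Keller–Osserman integral provides a
radius `R` such that, for every level `M ≥ c`, the increasing radial profile `W` with `W 0 = c`, `W'
0 = 0` and `(W'^{p-1})' = κ g(W)` has reached `M` by radius `R`. Here `g` is `-f` clamped to `[c,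
M]`, which keeps `W` globally defined. Since `R` does not depend on `M`, one may choose `M` above
`u` on the closed ball of radius `R`, so that `u < W(|x - x₀|)` on the sphere.

A radial field `h(|y|) y/|y|` with `h' = F` nondecreasing has divergence at most `N F`, so with `κ =
1/(2N)` the barrier satisfies `-div ≥ -g(W)/2`. Where it lies below `u`, monotonicity of `f` gives
`f(u) ≤ -g(W)`, which is smaller by at least `-f(c)/2 > 0`. Weak comparison then yields `u x₀ ≤ W 0
= c`, and `c` tends to `β`.

The carrying lemmas are `exists_radial_profile`, `neg_integral_le_integral_radial_field`,
`le_of_weak_inequalities` and `KellerOssermanAtTop.exists_bound`. -/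

theorem intervalIntegrable_abs_rpow {r : ℝ} (hr : -1 < r) (a b : ℝ) :
    IntervalIntegrable (fun t : ℝ => |t| ^ r) volume a b := by
  have pos : ∀ t : ℝ, 0 ≤ t → IntervalIntegrable (fun t : ℝ => |t| ^ r) volume 0 t := by
    intro t ht
    refine (intervalIntegral.intervalIntegrable_rpow' hr (a := 0) (b := t)).congr ?_
    intro s hs
    rw [uIoc_of_le ht] at hs
    simp only [abs_of_pos hs.1]
  have all : ∀ t : ℝ, IntervalIntegrable (fun t : ℝ => |t| ^ r) volume 0 t := by
    intro t
    rcases le_total 0 t with ht | ht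
    · exact pos t ht
    · rw [IntervalIntegrable.iff_comp_neg]
      simpa using pos (-t) (by linarith)
  exact (all a).symm.trans (all b)

/-! ### Scalar equations leaving a non-Lipschitz equilibrium, and the radial profile -/

section EscapeODE

variable {P : ℝ → ℝ} {θ A B : ℝ}

theorem intervalIntegrable_inv_of_rpow_le (hP : Continuous P) (hθ1 : θ < 1) (hA : 0 < A)
    (hlow : ∀ t, A * |t| ^ θ ≤ P t) (a b : ℝ) :
    IntervalIntegrable (fun t => (P t)⁻¹) volume a b := by
  refine ((intervalIntegrable_abs_rpow (r := -θ) (by linarith) a b).const_mul A⁻¹).mono_fun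
    hP.measurable.inv.aestronglyMeasurable ?_
  have hz : ∀ᵐ t : ℝ, t ≠ 0 := by
    simp [ae_iff]
  filter_upwards [ae_restrict_of_ae hz] with t ht
  have h1 : 0 < A * |t| ^ θ := mul_pos hA (Real.rpow_pos_of_pos (abs_pos.2 ht) _)
  have h2 := hlow t
  rw [Real.norm_of_nonneg (inv_nonneg.2 (h1.le.trans h2)), Real.rpow_neg (abs_nonneg _),
    ← mul_inv, Real.norm_of_nonneg (inv_nonneg.2 h1.le)]
  exact inv_anti₀ h1 h2

/-- Since `1 - θ > 0`, this forces the time needed to reach height `T` to diverge, so the solution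
is defined for all times. -/
theorem rpow_le_integral_inv (hP : Continuous P) (hθ0 : 0 ≤ θ) (hθ1 : θ < 1) (hA : 0 < A)
    (hB : 0 < B) (hlow : ∀ t, A * |t| ^ θ ≤ P t) (hup : ∀ t, P t ≤ B * |t| ^ θ) {T : ℝ}
    (hT : 0 < T) : B⁻¹ * T ^ (1 - θ) ≤ ∫ t in (0 : ℝ)..T, (P t)⁻¹ := by
  have h : ∫ t in (0 : ℝ)..T, (B * T ^ θ)⁻¹ ≤ ∫ t in (0 : ℝ)..T, (P t)⁻¹ := by
    refine intervalIntegral.integral_mono_on_of_le_Ioo hT.le (by simp)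
      (intervalIntegrable_inv_of_rpow_le hP hθ1 hA hlow 0 T) ?_
    intro t ht
    have h1 : 0 < A * |t| ^ θ :=
      mul_pos hA (Real.rpow_pos_of_pos (abs_pos.2 ht.1.ne') _)
    refine inv_anti₀ (h1.trans_le (hlow t)) ((hup t).trans ?_)
    rw [abs_of_pos ht.1]
    gcongr
    exacts [ht.1.le, ht.2.le]
  refine le_trans (le_of_eq ?_) h
  rw [intervalIntegral.integral_const, smul_eq_mul, sub_zero, Real.rpow_sub hT, Real.rpow_one,
    mul_inv]
  ring

/-- An autonomous scalar equation `W' = P(W)`, whose right-hand side vanishes at `0` like a power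
less than one, has a global strictly increasing solution through the equilibrium `0`. -/
theorem exists_strictMono_solution (hP : Continuous P) (hθ0 : 0 < θ) (hθ1 : θ < 1) (hA : 0 < A)
    (hB : 0 < B) (hlow : ∀ t, A * |t| ^ θ ≤ P t) (hup : ∀ t, P t ≤ B * |t| ^ θ) :
    ∃ W : ℝ → ℝ, StrictMono W ∧ W 0 = 0 ∧ (∀ r, HasDerivAt W (P (W r)) r) ∧
      ∀ t, W (∫ s in (0 : ℝ)..t, (P s)⁻¹) = t := by
  have hint := intervalIntegrable_inv_of_rpow_le hP hθ1 hA hlow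
  have hpos : ∀ t, t ≠ 0 → 0 < P t := fun t ht =>
    (mul_pos hA (Real.rpow_pos_of_pos (abs_pos.2 ht) _)).trans_le (hlow t)
  have hP0 : P 0 = 0 := by
    have h1 := hlow 0
    have h2 := hup 0
    simp only [abs_zero, Real.zero_rpow hθ0.ne', mul_zero] at h1 h2
    exact le_antisymm h2 h1
  -- Separation of variables: `ψ` is the inverse of the sought solution. Integrability of `1/P` at
  -- `0` is what selects a solution leaving the equilibrium, rather than the constant one.
  set ψ : ℝ → ℝ := fun t => ∫ s in (0 : ℝ)..t, (P s)⁻¹ with hψ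
  have hdiff : ∀ s t, ψ t - ψ s = ∫ x in s..t, (P x)⁻¹ := fun s t =>
    intervalIntegral.integral_interval_sub_left (hint _ _) (hint _ _)
  have hmono : StrictMono ψ := by
    refine StrictMonoOn.Iic_union_Ici (a := 0) ?_ ?_
    · intro s hs t ht hst
      rw [← sub_pos, hdiff]
      refine intervalIntegral.intervalIntegral_pos_of_pos_on (hint _ _) ?_ hst
      intro x hx
      exact inv_pos.2 (hpos x (hx.2.trans_le ht).ne)
    · intro s hs t ht hst
      rw [← sub_pos, hdiff]
      refine intervalIntegral.intervalIntegral_pos_of_pos_on (hint _ _) ?_ hst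
      intro x hx
      exact inv_pos.2 (hpos x (lt_of_le_of_lt hs hx.1).ne')
  have hcont : Continuous ψ := intervalIntegral.continuous_primitive hint 0
  have hpow : Tendsto (fun T : ℝ => B⁻¹ * T ^ (1 - θ)) atTop atTop :=
    (tendsto_rpow_atTop (by linarith)).const_mul_atTop (inv_pos.2 hB)
  have htop : Tendsto ψ atTop atTop := by
    refine tendsto_atTop_mono' _ ?_ hpow
    filter_upwards [eventually_gt_atTop 0] with T hT
    exact rpow_le_integral_inv hP hθ0.le hθ1 hA hB hlow hup hT
  have hbot : Tendsto ψ atBot atBot := by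
    have h1 : Tendsto (fun T => -ψ (-T)) atTop atTop := by
      refine tendsto_atTop_mono' _ ?_ hpow
      filter_upwards [eventually_gt_atTop 0] with T hT
      refine (rpow_le_integral_inv (P := fun t => P (-t)) (hP.comp continuous_neg) hθ0.le hθ1 hA
        hB (fun t => by simpa using hlow (-t)) (fun t => by simpa using hup (-t)) hT).trans ?_
      rw [intervalIntegral.integral_comp_neg (fun t => (P t)⁻¹), hψ]
      simp only [neg_zero]
      rw [intervalIntegral.integral_symm]
    have h2 := (tendsto_neg_atTop_atBot.comp h1).comp tendsto_neg_atBot_atTop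
    refine h2.congr fun x => by simp
  have hsurj : Function.Surjective ψ := hcont.surjective htop hbot
  let e : ℝ ≃o ℝ := hmono.orderIsoOfSurjective ψ hsurj
  have he : ∀ t, e t = ψ t := fun t => rfl
  have hψ0 : ψ 0 = 0 := by simp [hψ]
  have hW0 : e.symm 0 = 0 := by rw [e.symm_apply_eq, he, hψ0]
  have hWc : Continuous e.symm := e.symm.continuous
  have hder : ∀ r, r ≠ 0 → HasDerivAt e.symm (P (e.symm r)) r := by
    intro r hr
    have hne : e.symm r ≠ 0 := by
      intro h
      apply hr
      rw [e.symm_apply_eq, he, hψ0] at h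
      exact h
    have h1 : HasDerivAt ψ (P (e.symm r))⁻¹ (e.symm r) :=
      intervalIntegral.integral_hasDerivAt_right (hint _ _)
        (hP.measurable.inv.stronglyMeasurable.stronglyMeasurableAtFilter)
        (hP.continuousAt.inv₀ (hpos _ hne).ne')
    have h2 := HasDerivAt.of_local_left_inverse (g := e.symm) hWc.continuousAt h1
      (inv_ne_zero (hpos _ hne).ne') (Eventually.of_forall fun y => by rw [← he]; simp)
    rwa [inv_inv] at h2
  refine ⟨e.symm, e.symm.strictMono, hW0, fun r => ?_, fun t => ?_⟩
  -- The inverse rule fails at `r = 0`, where `P` vanishes; the derivative there is the limit of the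
  -- derivatives nearby.
  · rcases eq_or_ne r 0 with rfl | hr
    · exact hasDerivAt_of_hasDerivAt_of_ne (fun y hy => hder y hy) hWc.continuousAt
        (hP.comp hWc).continuousAt
    · exact hder r hr
  · exact e.symm_apply_apply t

end EscapeODE

/-- The radial profile of the blow-up comparison functions: a solution of
`(W'^{p-1})' = κ g(W)` with `W(0) = c` and `W'(0) = 0`. -/
theorem exists_radial_profile {p : ℝ} (hp : 1 < p) {κ : ℝ} (hκ : 0 < κ) {g : ℝ → ℝ}
    (hg : Continuous g) {m C : ℝ} (hm : 0 < m) (hgm : ∀ t, m ≤ g t) (hgC : ∀ t, g t ≤ C)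
    (c : ℝ) :
    ∃ W W' : ℝ → ℝ, StrictMono W ∧ W 0 = c ∧ Continuous W' ∧ W' 0 = 0 ∧
      (∀ r, HasDerivAt W (W' r) r) ∧
      (∀ r, 0 ≤ r → 0 ≤ W' r ∧ W' r ^ (p - 1) = ∫ s in (0 : ℝ)..r, κ * g (W s)) ∧
      ∀ t, c ≤ t →
        W (∫ x in c..t, (p / (p - 1) * κ * ∫ s in c..x, g s) ^ (-(1 / p))) = t := by
  have hp0 : 0 < p := by linarith
  have hp1 : 0 < p - 1 := by linarith
  -- Multiplying the equation by `W'` and integrating gives `((p-1)/p) W'^p = κ ∫_c^W g`; this fixes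
  -- the constant `a`.
  set a : ℝ := p / (p - 1) * κ with ha
  have ha0 : 0 < a := by positivity
  set G : ℝ → ℝ := fun t => ∫ s in c..(c + t), g s with hG
  have hgi : ∀ x y, IntervalIntegrable g volume x y := fun x y => hg.intervalIntegrable _ _
  have hGd : ∀ t, HasDerivAt G (g (c + t)) t := by
    intro t
    have h := (intervalIntegral.integral_hasDerivAt_right (hgi c (c + t))
      hg.stronglyMeasurable.stronglyMeasurableAtFilter hg.continuousAt).comp_const_add c t
    exact h
  have hGc : Continuous G := continuous_iff_continuousAt.2 fun t => (hGd t).continuousAt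
  have hC : 0 < C := hm.trans_le ((hgm 0).trans (hgC 0))
  have hGpos : ∀ t, 0 ≤ t → m * t ≤ G t ∧ G t ≤ C * t := by
    intro t ht
    have hct : c ≤ c + t := by linarith
    constructor
    · have := intervalIntegral.integral_mono_on hct (by simp) (hgi _ _)
        (fun x _ => hgm x) (μ := volume)
      simpa [mul_comm] using this
    · have := intervalIntegral.integral_mono_on hct (hgi _ _) (by simp)
        (fun x _ => hgC x) (μ := volume)
      simpa [mul_comm] using this
  have hGneg : ∀ t, t ≤ 0 → G t ≤ m * t ∧ C * t ≤ G t := by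
    intro t ht
    have hct : c + t ≤ c := by linarith
    have e : G t = -∫ s in (c + t)..c, g s := intervalIntegral.integral_symm _ _
    constructor
    · have := intervalIntegral.integral_mono_on hct (by simp) (hgi _ _)
        (fun x _ => hgm x) (μ := volume)
      simp at this
      rw [e]; linarith
    · have := intervalIntegral.integral_mono_on hct (hgi _ _) (by simp)
        (fun x _ => hgC x) (μ := volume)
      simp at this
      rw [e]; linarith
  have hGabs : ∀ t, m * |t| ≤ |G t| ∧ |G t| ≤ C * |t| := by
    intro t
    rcases le_total 0 t with ht | ht
    · obtain ⟨h1, h2⟩ := hGpos t ht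
      have h3 : 0 ≤ m * t := by positivity
      rw [abs_of_nonneg ht, abs_of_nonneg (h3.trans h1)]
      exact ⟨h1, h2⟩
    · obtain ⟨h1, h2⟩ := hGneg t ht
      have h3 : m * t ≤ 0 := mul_nonpos_of_nonneg_of_nonpos hm.le ht
      rw [abs_of_nonpos ht, abs_of_nonpos (h1.trans h3)]
      constructor <;> linarith
  -- The absolute value makes `P` positive on both sides of `0`, as a global increasing solution
  -- requires; the second-order equation is claimed only for `r ≥ 0`, where `G (W r) ≥ 0`.
  set P : ℝ → ℝ := fun t => (a * |G t|) ^ (1 / p) with hPdef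
  have hPc : Continuous P := by
    refine (continuous_const.mul hGc.abs).rpow_const fun _ => Or.inr (by positivity)
  obtain ⟨W, hWm, hW0, hWd, hWinv⟩ := exists_strictMono_solution (θ := 1 / p)
    (A := (a * m) ^ (1 / p)) (B := (a * C) ^ (1 / p)) hPc (by positivity)
    (by rw [div_lt_one hp0]; exact hp) (by positivity) (by positivity)
    (fun t => by
      rw [← Real.mul_rpow (by positivity) (abs_nonneg _), mul_assoc]
      have := (hGabs t).1
      exact Real.rpow_le_rpow (by positivity) (by gcongr) (by positivity))
    (fun t => by
      rw [← Real.mul_rpow (by positivity) (abs_nonneg _), mul_assoc]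
      have := (hGabs t).2
      exact Real.rpow_le_rpow (by positivity) (by gcongr) (by positivity))
  have hWc : Continuous W := continuous_iff_continuousAt.2 fun t => (hWd t).continuousAt
  have hG0 : G 0 = 0 := by simp [hG]
  have hP0 : P 0 = 0 := by
    simp only [hPdef, hG0, abs_zero, mul_zero]
    exact Real.zero_rpow (by positivity)
  refine ⟨fun r => c + W r, fun r => P (W r), fun x y h => by simpa using hWm h, by simp [hW0],
    hPc.comp hWc, by simp [hW0, hP0], fun r => (hWd r).const_add c, fun r hr => ⟨?_, ?_⟩, ?_⟩
  · exact Real.rpow_nonneg (by positivity) _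
  · have key : ∀ s, 0 ≤ s → P (W s) ^ (p - 1) = (a * G (W s)) ^ (1 - 1 / p) := by
      intro s hs
      have hWs : 0 ≤ W s := by rw [← hW0]; exact hWm.monotone hs
      have hGs : 0 ≤ G (W s) := le_trans (by positivity) (hGpos _ hWs).1
      simp only [hPdef]
      rw [abs_of_nonneg hGs, ← Real.rpow_mul (by positivity)]
      congr 1
      field_simp
    have hcontH : Continuous fun s => P (W s) ^ (p - 1) :=
      (hPc.comp hWc).rpow_const fun _ => Or.inr hp1.le
    have hI := intervalIntegral.integral_eq_sub_of_hasDeriv_right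
      (f := fun s => P (W s) ^ (p - 1)) (f' := fun s => κ * g (c + W s)) (a := 0) (b := r)
      hcontH.continuousOn ?_
      ((continuous_const.mul (hg.comp (continuous_const.add hWc))).intervalIntegrable _ _)
    · rw [hI]
      simp [hW0, hP0, Real.zero_rpow hp1.ne']
    · intro s hs
      rw [min_eq_left hr, max_eq_right hr] at hs
      have hWs : 0 < W s := by rw [← hW0]; exact hWm hs.1
      have hGs : 0 < G (W s) := lt_of_lt_of_le (by positivity) (hGpos _ hWs.le).1
      -- The factor `W' = (a G)^{1/p}` cancels the power `-(1/p)` from the chain rule, leaving `a (1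
      -- - 1/p) g = κ g`.
      have h1 : HasDerivAt (fun s => (a * G (W s)) ^ (1 - 1 / p)) (κ * g (c + W s)) s := by
        have h := (((hGd (W s)).comp s (hWd s)).const_mul a).rpow_const (p := 1 - 1 / p)
          (Or.inl (by simp only [Function.comp]; positivity))
        refine h.congr_deriv ?_
        simp only [Function.comp, hPdef, abs_of_pos hGs]
        have e1 : (1 : ℝ) - 1 / p - 1 = -(1 / p) := by ring
        have hX : 0 < a * G (W s) := by positivity
        rw [e1, Real.rpow_neg hX.le]
        have hX' : (a * G (W s)) ^ (1 / p) ≠ 0 := (Real.rpow_pos_of_pos hX _).ne'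
        field_simp
        rw [ha]
        field_simp
      refine (h1.congr_of_eventuallyEq ?_).hasDerivWithinAt
      filter_upwards [lt_mem_nhds hs.1] with y hy
      exact key y hy.le
  · intro t ht
    have h := hWinv (t - c)
    have e : ∫ x in c..t, (a * ∫ s in c..x, g s) ^ (-(1 / p)) =
        ∫ s in (0 : ℝ)..(t - c), (P s)⁻¹ := by
      have h1 := intervalIntegral.integral_comp_add_left (a := 0) (b := t - c)
        (fun x => (a * ∫ s in c..x, g s) ^ (-(1 / p))) c
      rw [add_zero, add_sub_cancel] at h1
      rw [← h1]
      refine intervalIntegral.integral_congr fun x hx => ?_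
      rw [uIcc_of_le (by linarith)] at hx
      have hGx : 0 ≤ G x := le_trans (mul_nonneg hm.le hx.1) (hGpos x hx.1).1
      simp only [hPdef]
      rw [abs_of_nonneg hGx, ← Real.rpow_neg (by positivity)]
    simp only [e, h]
    ring

/-! ### The field `|v|^{p-2} v` and gradients of radial functions -/

section Flux

variable {E : Type*} [NormedAddCommGroup E] [InnerProductSpace ℝ E]

/-- The field has norm `|φ(|v|)|` for `v ≠ 0`, so `φ 0 = 0` gives continuity at the origin even when
the scalar factor is singular there, as for `|v|^{p-2} v` with `p < 2`. -/
theorem continuous_radial_smul {φ : ℝ → ℝ} (hφ : Continuous φ) (h0 : φ 0 = 0) :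
    Continuous fun v : E => (φ ‖v‖ / ‖v‖) • v := by
  refine continuous_iff_continuousAt.2 fun v => ?_
  rcases eq_or_ne v 0 with rfl | hv
  · have h1 : Tendsto (fun v : E => |φ ‖v‖|) (𝓝 0) (𝓝 0) := by
      have : Continuous fun v : E => |φ ‖v‖| := (hφ.comp continuous_norm).abs
      simpa [h0] using this.tendsto 0
    unfold ContinuousAt
    simp only [smul_zero]
    refine squeeze_zero_norm (fun v => ?_) h1
    rw [norm_smul, norm_div, norm_norm, Real.norm_eq_abs]
    rcases eq_or_ne v 0 with rfl | hv
    · simp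
    · rw [div_mul_cancel₀ _ (norm_ne_zero_iff.2 hv)]
  · exact ((hφ.comp continuous_norm).continuousAt.div continuous_norm.continuousAt
      (norm_ne_zero_iff.2 hv)).smul continuousAt_id

theorem rpow_sub_two_smul_eq (p : ℝ) (v : E) :
    ‖v‖ ^ (p - 2) • v = (‖v‖ ^ (p - 1) / ‖v‖) • v := by
  rcases eq_or_ne v 0 with rfl | hv
  · simp
  · rw [← Real.rpow_sub_one (norm_ne_zero_iff.2 hv)]
    congr 2
    ring

theorem continuous_norm_rpow_smul {p : ℝ} (hp : 1 < p) :
    Continuous fun v : E => ‖v‖ ^ (p - 2) • v := by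
  simp only [rpow_sub_two_smul_eq p]
  exact continuous_radial_smul (φ := fun r => r ^ (p - 1))
    (Real.continuous_rpow_const (by linarith)) (Real.zero_rpow (by linarith))

/-- Monotonicity of the vector field `v ↦ |v|^{p-2} v`. -/
theorem inner_norm_rpow_smul_sub_nonneg {p : ℝ} (hp : 1 < p) (v w : E) :
    0 ≤ ⟪‖v‖ ^ (p - 2) • v - ‖w‖ ^ (p - 2) • w, v - w⟫ := by
  have e : ∀ v : E, ‖v‖ ^ (p - 2) * ‖v‖ = ‖v‖ ^ (p - 1) := by
    intro v
    rcases eq_or_ne v 0 with rfl | hv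
    · simp [Real.zero_rpow (show p - 1 ≠ 0 by linarith)]
    · rw [← Real.rpow_add_one (norm_ne_zero_iff.2 hv)]
      congr 1
      ring
  have hv := e v
  have hw := e w
  -- By Cauchy–Schwarz the inner product is at least `(|v|^{p-1} - |w|^{p-1})(|v| - |w|)`.
  have hm : 0 ≤ (‖v‖ ^ (p - 1) - ‖w‖ ^ (p - 1)) * (‖v‖ - ‖w‖) := by
    rcases le_total ‖v‖ ‖w‖ with h | h
    · have := Real.rpow_le_rpow (norm_nonneg v) h (show 0 ≤ p - 1 by linarith)
      exact mul_nonneg_of_nonpos_of_nonpos (by linarith) (by linarith)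
    · have := Real.rpow_le_rpow (norm_nonneg w) h (show 0 ≤ p - 1 by linarith)
      exact mul_nonneg (by linarith) (by linarith)
  have h1 := real_inner_le_norm v w
  set A := ‖v‖ ^ (p - 2) with hA
  set B := ‖w‖ ^ (p - 2) with hB
  have hA0 : 0 ≤ A := Real.rpow_nonneg (norm_nonneg _) _
  have hB0 : 0 ≤ B := Real.rpow_nonneg (norm_nonneg _) _
  have h2 := mul_le_mul_of_nonneg_left h1 (add_nonneg hA0 hB0)
  rw [← hv, ← hw] at hm
  simp only [inner_sub_left, inner_sub_right, real_inner_smul_left, real_inner_self_eq_norm_sq,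
    real_inner_comm v w]
  nlinarith

theorem hasFDerivAt_norm_of_ne_zero {x : E} (hx : x ≠ 0) :
    HasFDerivAt (fun y : E => ‖y‖) (‖x‖⁻¹ • innerSL ℝ x) x := by
  have h := (hasStrictFDerivAt_norm_sq x).hasFDerivAt.sqrt (by simpa using hx)
  simp only [Real.sqrt_sq (norm_nonneg _)] at h
  refine h.congr_fderiv ?_
  ext y
  have : ‖x‖ ≠ 0 := norm_ne_zero_iff.2 hx
  simp
  field_simp

variable [CompleteSpace E]

theorem hasGradientAt_radial {W W' : ℝ → ℝ} (hW : ∀ r, HasDerivAt W (W' r) r) (h0 : W' 0 = 0)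
    (x₀ x : E) :
    HasGradientAt (fun y => W ‖y - x₀‖) ((W' ‖x - x₀‖ / ‖x - x₀‖) • (x - x₀)) x := by
  rw [hasGradientAt_iff_hasFDerivAt]
  have key : ∀ z : E, HasFDerivAt (fun y : E => W ‖y‖)
      (InnerProductSpace.toDual ℝ E ((W' ‖z‖ / ‖z‖) • z)) z := by
    intro z
    rcases eq_or_ne z 0 with rfl | hz
    · simp only [smul_zero, map_zero]
      have h1 := hW 0
      rw [h0, hasDerivAt_iff_isLittleO_nhds_zero] at h1
      rw [hasFDerivAt_iff_isLittleO_nhds_zero]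
      have ht : Tendsto (fun y : E => ‖y‖) (𝓝 0) (𝓝 0) := by
        simpa using (continuous_norm (E := E)).tendsto 0
      have h2 := Asymptotics.isLittleO_norm_right.1 (h1.comp_tendsto ht)
      simpa [Function.comp_def] using h2
    · refine ((hW ‖z‖).comp_hasFDerivAt z (hasFDerivAt_norm_of_ne_zero hz)).congr_fderiv ?_
      ext y
      simp
      ring
  exact (key (x - x₀)).comp x ((hasFDerivAt_id x).sub_const x₀)

theorem contDiff_radial {W W' : ℝ → ℝ} (hW : ∀ r, HasDerivAt W (W' r) r) (hc : Continuous W')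
    (h0 : W' 0 = 0) (x₀ : E) : ContDiff ℝ 1 fun x => W ‖x - x₀‖ := by
  rw [contDiff_one_iff_fderiv]
  have hg := hasGradientAt_radial hW h0 x₀
  refine ⟨fun x => (hg x).differentiableAt, ?_⟩
  rw [← toDual_comp_gradient, gradient_eq hg]
  exact (InnerProductSpace.toDual ℝ E).continuous.comp
    ((continuous_radial_smul hc h0).comp (continuous_id.sub continuous_const))

theorem continuous_gradient {u : E → ℝ} (hu : ContDiff ℝ 1 u) : Continuous (gradient u) :=
  (InnerProductSpace.toDual ℝ E).symm.continuous.comp (hu.continuous_fderiv one_ne_zero)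

end Flux

section pFlux

variable {N : ℕ} {p : ℝ}

theorem continuous_pFlux (hp : 1 < p) {u : EuclideanSpace ℝ (Fin N) → ℝ} (hu : ContDiff ℝ 1 u) :
    Continuous (pFlux p u) :=
  (continuous_norm_rpow_smul hp).comp (continuous_gradient hu)

theorem pFlux_radial (hp : 1 < p) {W W' : ℝ → ℝ} (hW : ∀ r, HasDerivAt W (W' r) r)
    (h0 : W' 0 = 0) (hn : ∀ r, 0 ≤ r → 0 ≤ W' r) (x₀ x : EuclideanSpace ℝ (Fin N)) :
    pFlux p (fun y => W ‖y - x₀‖) x = (W' ‖x - x₀‖ ^ (p - 1) / ‖x - x₀‖) • (x - x₀) := by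
  unfold pFlux
  rw [(hasGradientAt_radial hW h0 x₀ x).gradient, rpow_sub_two_smul_eq p]
  set y := x - x₀
  rcases eq_or_ne y 0 with hy | hy
  · simp [hy]
  have hy' : ‖y‖ ≠ 0 := norm_ne_zero_iff.2 hy
  have hn' : ‖(W' ‖y‖ / ‖y‖) • y‖ = W' ‖y‖ := by
    rw [norm_smul, norm_div, norm_norm, div_mul_cancel₀ _ hy',
      Real.norm_of_nonneg (hn _ (norm_nonneg _))]
  rw [hn', smul_smul]
  congr 1
  rcases eq_or_ne (W' ‖y‖) 0 with h | h
  · simp [h, Real.zero_rpow (show p - 1 ≠ 0 by linarith)]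
  · field_simp

theorem pFlux_neg (u : EuclideanSpace ℝ (Fin N) → ℝ) (x : EuclideanSpace ℝ (Fin N)) :
    pFlux p (fun y => -u y) x = -pFlux p u x := by
  have : gradient (fun y => -u y) x = -gradient u x := by
    simp [gradient, fderiv_fun_neg]
  simp [pFlux, this]

end pFlux

/-! ### Weak divergence of radial fields -/

section RadialDivergence

variable {N : ℕ}

theorem hasDerivAt_line_coord (y : EuclideanSpace ℝ (Fin N)) (i : Fin N) :
    HasDerivAt (fun t : ℝ => (y + t • EuclideanSpace.single i (1 : ℝ)) i) 1 0 := by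
  simpa using (hasDerivAt_id (0 : ℝ)).const_add (y i)

/-- The partial derivative `∂ᵢ` of the `i`-th component of a radial field `k(|y|) y`,
where `k(r) = h(r) / r`. -/
theorem hasLineDerivAt_radial_field {h F : ℝ → ℝ} (hh : ∀ r, HasDerivAt h (F r) r) (h0 : h 0 = 0)
    (x₀ x : EuclideanSpace ℝ (Fin N)) (i : Fin N) :
    HasLineDerivAt ℝ (fun x => dslope h 0 ‖x - x₀‖ * (x - x₀) i)
      (dslope h 0 ‖x - x₀‖ +
        (F ‖x - x₀‖ - dslope h 0 ‖x - x₀‖) * ((x - x₀) i / ‖x - x₀‖) ^ 2) x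
      (EuclideanSpace.single i 1) := by
  unfold HasLineDerivAt
  have hsub : ∀ t : ℝ, x + t • EuclideanSpace.single i (1 : ℝ) - x₀ =
      (x - x₀) + t • EuclideanSpace.single i (1 : ℝ) := fun t => by abel
  simp only [hsub]
  set y := x - x₀
  rcases eq_or_ne y 0 with hy | hy
  -- At the centre the component restricted to the line is `k(|t|) t`, with derivative `k(0)`; the
  -- quotient `y i / ‖y‖` is `0` by convention, so the formula persists.
  · rw [hy]
    have hk : ContinuousAt (fun t : ℝ => dslope h 0 |t|) 0 := by
      refine ContinuousAt.comp (g := dslope h 0) ?_ continuous_abs.continuousAt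
      rw [abs_zero]
      exact continuousAt_dslope_same.2 (hh 0).differentiableAt
    have hd : HasDerivAt (fun t : ℝ => dslope h 0 |t| * t) (dslope h 0 0) 0 := by
      rw [hasDerivAt_iff_tendsto_slope]
      have h1 : Tendsto (fun t : ℝ => dslope h 0 |t|) (𝓝[≠] 0) (𝓝 (dslope h 0 0)) := by
        have := hk.tendsto.mono_left (nhdsWithin_le_nhds (s := {0}ᶜ))
        simpa using this
      refine h1.congr' ?_
      filter_upwards [self_mem_nhdsWithin] with t ht
      have ht : t ≠ 0 := ht
      simp [slope_def_field]
      field_simp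
    simpa [norm_smul] using hd
  · have hy' : ‖y‖ ≠ 0 := norm_ne_zero_iff.2 hy
    have hl : HasDerivAt (fun t : ℝ => y + t • EuclideanSpace.single i (1 : ℝ))
        (EuclideanSpace.single i (1 : ℝ)) 0 := by
      simpa using ((hasDerivAt_id (0 : ℝ)).smul_const
        (EuclideanSpace.single i (1 : ℝ))).const_add y
    have hn : HasDerivAt (fun t : ℝ => ‖y + t • EuclideanSpace.single i (1 : ℝ)‖)
        (y i / ‖y‖) 0 := by
      have h1 : HasFDerivAt (fun y : EuclideanSpace ℝ (Fin N) => ‖y‖) (‖y‖⁻¹ • innerSL ℝ y)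
          (y + (0 : ℝ) • EuclideanSpace.single i (1 : ℝ)) := by
        simpa using hasFDerivAt_norm_of_ne_zero hy
      refine (h1.comp_hasDerivAt 0 hl).congr_deriv ?_
      simp [EuclideanSpace.inner_single_right]
      ring
    have hq : HasDerivAt (fun t : ℝ => h ‖y + t • EuclideanSpace.single i (1 : ℝ)‖ /
        ‖y + t • EuclideanSpace.single i (1 : ℝ)‖ * (y + t • EuclideanSpace.single i (1 : ℝ)) i)
        ((F ‖y‖ * (y i / ‖y‖) * ‖y‖ - h ‖y‖ * (y i / ‖y‖)) / ‖y‖ ^ 2 * y i + h ‖y‖ / ‖y‖ * 1)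
        0 := by
      have h2 := (HasDerivAt.comp 0 (h₂ := h) (hh _) hn).div hn (by simpa using hy')
      have h3 := h2.mul (hasDerivAt_line_coord y i)
      exact h3.congr_deriv (by simp)
    have hval : dslope h 0 ‖y‖ = h ‖y‖ / ‖y‖ := by
      rw [dslope_of_ne _ hy', slope_def_field]
      simp [h0]
    refine (hq.congr_of_eventuallyEq ?_).congr_deriv ?_
    · have hne : ∀ᶠ t : ℝ in 𝓝 0, y + t • EuclideanSpace.single i (1 : ℝ) ≠ 0 :=
        hl.continuousAt.eventually_ne (by simpa using hy)
      filter_upwards [hne] with t ht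
      rw [dslope_of_ne _ (norm_ne_zero_iff.2 ht), slope_def_field]
      simp [h0]
    · rw [hval]
      field_simp
      ring

/-- A radial field `h(|y|) y / |y|` with `h' = F` nondecreasing and nonnegative has, weakly,
divergence at most `N F(|y|)`. -/
theorem neg_integral_le_integral_radial_field (hN : 0 < N) {F : ℝ → ℝ} (hF : Continuous F)
    (hmono : Monotone F) {C : ℝ} (hF0 : ∀ r, 0 ≤ F r) (hFC : ∀ r, F r ≤ C)
    (x₀ : EuclideanSpace ℝ (Fin N)) {φ : EuclideanSpace ℝ (Fin N) → ℝ} (hφ : ContDiff ℝ 1 φ)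
    (hφc : HasCompactSupport φ) (hφ0 : ∀ x, 0 ≤ φ x) :
    -∫ x, N * F ‖x - x₀‖ * φ x ≤
      ∫ x, ⟪((∫ s in (0 : ℝ)..‖x - x₀‖, F s) / ‖x - x₀‖) • (x - x₀), gradient φ x⟫ := by
  set h : ℝ → ℝ := fun r => ∫ s in (0 : ℝ)..r, F s with hh
  have hd : ∀ r, HasDerivAt h (F r) r := fun r =>
    intervalIntegral.integral_hasDerivAt_right (hF.intervalIntegrable _ _)
      hF.stronglyMeasurable.stronglyMeasurableAtFilter hF.continuousAt
  have h0 : h 0 = 0 := by simp [hh]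
  set k : ℝ → ℝ := dslope h 0 with hk
  have hkc : Continuous k := by
    refine continuous_iff_continuousAt.2 fun r => ?_
    rcases eq_or_ne r 0 with rfl | hr
    · exact continuousAt_dslope_same.2 (hd 0).differentiableAt
    · exact (continuousAt_dslope_of_ne hr).2 (hd r).continuousAt
  have hk0 : k 0 = F 0 := by rw [hk, dslope_same, (hd 0).deriv]
  have hkval : ∀ r, r ≠ 0 → k r = h r / r := fun r hr => by
    rw [hk, dslope_of_ne _ hr, slope_def_field]
    simp [h0]
  -- For `r > 0`, `k r` is the mean of the nondecreasing `F` over `[0, r]`.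
  have hkF : ∀ r, 0 ≤ r → 0 ≤ k r ∧ k r ≤ F r := by
    intro r hr
    rcases hr.eq_or_lt with rfl | hr
    · exact ⟨by rw [hk0]; exact hF0 0, hk0.le⟩
    · rw [hkval r hr.ne']
      constructor
      · exact div_nonneg (intervalIntegral.integral_nonneg hr.le fun s _ => hF0 s) hr.le
      · rw [div_le_iff₀ hr]
        have := intervalIntegral.integral_mono_on hr.le (hF.intervalIntegrable 0 r) (by simp)
          (fun s hs => hmono hs.2) (μ := volume)
        simpa [hh, mul_comm] using this
  set D : Fin N → EuclideanSpace ℝ (Fin N) → ℝ := fun i x =>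
    k ‖x - x₀‖ + (F ‖x - x₀‖ - k ‖x - x₀‖) * ((x - x₀) i / ‖x - x₀‖) ^ 2 with hD
  have hsub : Continuous fun x : EuclideanSpace ℝ (Fin N) => x - x₀ :=
    continuous_id.sub continuous_const
  have hcoord : ∀ i : Fin N, Continuous fun x : EuclideanSpace ℝ (Fin N) => (x - x₀) i :=
    fun i => by fun_prop
  have hkn : Continuous fun x : EuclideanSpace ℝ (Fin N) => k ‖x - x₀‖ := hkc.comp hsub.norm
  have hFn : Continuous fun x : EuclideanSpace ℝ (Fin N) => F ‖x - x₀‖ := hF.comp hsub.norm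
  have hDm : ∀ i, Measurable (D i) := fun i =>
    hkn.measurable.add ((hFn.measurable.sub hkn.measurable).mul
      (((hcoord i).measurable.div hsub.norm.measurable).pow_const 2))
  have hDb : ∀ i x, ‖D i x‖ ≤ 2 * C := by
    intro i x
    obtain ⟨h1, h2⟩ := hkF ‖x - x₀‖ (norm_nonneg _)
    have h3 := hFC ‖x - x₀‖
    have h4 : ((x - x₀) i / ‖x - x₀‖) ^ 2 ≤ 1 := by
      rw [div_pow]
      refine div_le_one_of_le₀ ?_ (sq_nonneg _)
      rw [← sq_abs]
      gcongr
      exact PiLp.norm_apply_le (x - x₀) i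
    have h5 := sq_nonneg ((x - x₀) i / ‖x - x₀‖)
    have h6 : 0 ≤ (F ‖x - x₀‖ - k ‖x - x₀‖) * ((x - x₀) i / ‖x - x₀‖) ^ 2 :=
      mul_nonneg (by linarith) h5
    have h7 := mul_le_mul_of_nonneg_left h4 (show 0 ≤ F ‖x - x₀‖ - k ‖x - x₀‖ by linarith)
    rw [Real.norm_of_nonneg (by simp only [hD]; linarith)]
    simp only [hD]
    linarith
  -- Away from `x₀` the sum is `F + (N - 1) k`, and `k ≤ F`. The bound `h3` also covers `x₀`, where
  -- the quotient is `0`.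
  have hsum : ∀ x, ∑ i, D i x ≤ N * F ‖x - x₀‖ := by
    intro x
    obtain ⟨h1, h2⟩ := hkF ‖x - x₀‖ (norm_nonneg _)
    simp only [hD, Finset.sum_add_distrib, ← Finset.mul_sum, div_pow, ← Finset.sum_div]
    rw [Finset.sum_const, Finset.card_univ, Fintype.card_fin, nsmul_eq_mul]
    have hs : ∑ i, (x - x₀) i ^ 2 = ‖x - x₀‖ ^ 2 := by
      rw [EuclideanSpace.norm_sq_eq]
      simp
    rw [hs]
    have hN1 : (1 : ℝ) ≤ N := by exact_mod_cast hN
    have h3 : ‖x - x₀‖ ^ 2 / ‖x - x₀‖ ^ 2 ≤ 1 := div_self_le_one _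
    have h4 := mul_le_mul_of_nonneg_left h3 (show 0 ≤ F ‖x - x₀‖ - k ‖x - x₀‖ by linarith)
    have h5 := mul_le_mul_of_nonneg_left h2 (show (0 : ℝ) ≤ N - 1 by linarith)
    linarith
  have hφi : Integrable φ := hφ.continuous.integrable_of_hasCompactSupport hφc
  have hDφ : ∀ i, Integrable fun x => D i x * φ x := fun i =>
    hφi.bdd_mul (hDm i).aestronglyMeasurable (Eventually.of_forall (hDb i))
  have hdφc : ∀ i : Fin N, Continuous fun x => fderiv ℝ φ x (EuclideanSpace.single i 1) := fun i =>
    (hφ.continuous_fderiv one_ne_zero).clm_apply continuous_const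
  have hdφs : ∀ i : Fin N, HasCompactSupport fun x => fderiv ℝ φ x (EuclideanSpace.single i 1) :=
    fun i => hφc.fderiv_apply (𝕜 := ℝ) _
  have hVc : ∀ i : Fin N, Continuous fun x => k ‖x - x₀‖ * (x - x₀) i := fun i =>
    hkn.mul (hcoord i)
  have hVdφ : ∀ i : Fin N, Integrable fun x =>
      k ‖x - x₀‖ * (x - x₀) i * fderiv ℝ φ x (EuclideanSpace.single i 1) := fun i =>
    ((hVc i).mul (hdφc i)).integrable_of_hasCompactSupport (hdφs i).mul_left
  have hparts : ∀ i : Fin N,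
      ∫ x, k ‖x - x₀‖ * (x - x₀) i * fderiv ℝ φ x (EuclideanSpace.single i 1) =
        -∫ x, D i x * φ x := fun i =>
    integral_bilinear_hasLineDerivAt_right_eq_neg_left_of_integrable
      (B := ContinuousLinearMap.mul ℝ ℝ) (hDφ i) (hVdφ i)
      (((hVc i).mul hφ.continuous).integrable_of_hasCompactSupport hφc.mul_left)
      (fun x _ => hasLineDerivAt_radial_field hd h0 x₀ x i)
      (fun x _ => ((hφ.differentiable one_ne_zero) x).hasFDerivAt.hasLineDerivAt _)
  have hinner : ∀ x, ⟪(h ‖x - x₀‖ / ‖x - x₀‖) • (x - x₀), gradient φ x⟫ =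
      ∑ i, k ‖x - x₀‖ * (x - x₀) i * fderiv ℝ φ x (EuclideanSpace.single i 1) := by
    intro x
    have e : (h ‖x - x₀‖ / ‖x - x₀‖) • (x - x₀) = k ‖x - x₀‖ • (x - x₀) := by
      rcases eq_or_ne (x - x₀) 0 with hy | hy
      · simp [hy]
      · rw [hkval _ (norm_ne_zero_iff.2 hy)]
    rw [e, PiLp.inner_apply]
    refine Finset.sum_congr rfl fun i _ => ?_
    have : gradient φ x i = fderiv ℝ φ x (EuclideanSpace.single i 1) := by
      rw [← inner_gradient_left, EuclideanSpace.inner_single_right]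
      simp
    rw [← this]
    simp
    ring
  change -∫ x, N * F ‖x - x₀‖ * φ x ≤
    ∫ x, ⟪(h ‖x - x₀‖ / ‖x - x₀‖) • (x - x₀), gradient φ x⟫
  simp only [hinner]
  rw [integral_finsetSum _ fun i _ => hVdφ i]
  simp only [hparts, Finset.sum_neg_distrib]
  rw [← integral_finsetSum _ fun i _ => hDφ i, neg_le_neg_iff]
  refine integral_mono (integrable_finsetSum _ fun i _ => hDφ i)
    (((continuous_const.mul hFn).mul hφ.continuous).integrable_of_hasCompactSupport
      hφc.mul_left) fun x => ?_
  rw [← Finset.sum_mul]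
  exact mul_le_mul_of_nonneg_right (hsum x) (hφ0 x)

end RadialDivergence

/-! ### Changing the base point in the Keller–Osserman condition -/

/-- Above `β` the base point in the Keller–Osserman condition is immaterial. -/
theorem KellerOssermanAtTop.of_lt {p : ℝ} (hp : 1 < p) {f : ℝ → ℝ} (hf : Continuous f) {β b c : ℝ}
    (hneg : ∀ t, β < t → f t < 0) (hanti : AntitoneOn f (Ioi β)) (hb : β ≤ b) (hc : β < c)
    (h : KellerOssermanAtTop p f b) : KellerOssermanAtTop p f c := by
  unfold KellerOssermanAtTop at h ⊢
  have hp0 : 0 < p := by linarith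
  have hexp : -(1 / p) ≤ 0 := by
    have : 0 < 1 / p := by positivity
    linarith
  have hfi : ∀ x y, IntervalIntegrable (fun s => -f s) volume x y := fun x y =>
    hf.neg.intervalIntegrable _ _
  have hpos : ∀ t, b < t → 0 < ∫ s in b..t, -f s := fun t ht =>
    intervalIntegral.intervalIntegral_pos_of_pos_on (hfi _ _)
      (fun s hs => by have := hneg s (hb.trans_lt hs.1); linarith) ht
  -- If `b ≤ c`, translate by `c - b`: as `-f` is nondecreasing, the shifted inner integral
  -- dominates the original one. If `c < b`, the inner integral only grows on `(b, ∞)`, while on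
  -- `(c, b]` it is at least `-f(c) (t - c)`, whose power `-1/p` is integrable because `p > 1`.
  rcases le_or_gt b c with hbc | hcb
  · have e : ∫⁻ t in Ioi c, ENNReal.ofReal ((∫ s in c..t, -f s) ^ (-(1 / p))) =
        ∫⁻ t in Ioi b, ENNReal.ofReal ((∫ s in c..(t + (c - b)), -f s) ^ (-(1 / p))) := by
      have h1 := (measurePreserving_add_right (volume : Measure ℝ) (c - b)).setLIntegral_comp_emb
        (measurableEmbedding_addRight (c - b))
        (fun t => ENNReal.ofReal ((∫ s in c..t, -f s) ^ (-(1 / p)))) (Ioi b)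
      rw [h1, image_add_const_Ioi, add_sub_cancel]
    rw [e]
    refine lt_of_le_of_lt (setLIntegral_mono' measurableSet_Ioi fun t ht => ?_) h
    refine ENNReal.ofReal_le_ofReal (Real.rpow_le_rpow_of_nonpos (hpos t ht) ?_ hexp)
    have h2 := intervalIntegral.integral_comp_add_right (a := b) (b := t) (fun s => -f s) (c - b)
    rw [add_sub_cancel] at h2
    rw [← h2]
    refine intervalIntegral.integral_mono_on_of_le_Ioo (le_of_lt ht) (hfi _ _)
      ((hf.comp (continuous_id.add continuous_const)).neg.intervalIntegrable _ _) fun s hs => ?_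
    have hs1 : β < s := hb.trans_lt hs.1
    exact neg_le_neg (hanti hs1 (show β < s + (c - b) by linarith) (by linarith))
  · rw [← Ioc_union_Ioi_eq_Ioi hcb.le]
    refine (lintegral_union_le _ _ _).trans_lt (ENNReal.add_lt_top.2 ⟨?_, ?_⟩)
    · have hm : 0 < -f c := by have := hneg c hc; linarith
      have hI : IntervalIntegrable (fun t : ℝ => (-f c) ^ (-(1 / p)) * |t - c| ^ (-(1 / p)))
          volume c b := by
        have hr : -1 < -(1 / p) := by
          have : 1 / p < 1 := by rw [div_lt_one hp0]; exact hp
          linarith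
        have := ((intervalIntegrable_abs_rpow hr 0 (b - c)).comp_sub_right c).const_mul
          ((-f c) ^ (-(1 / p)))
        simpa using this
      rw [intervalIntegrable_iff_integrableOn_Ioc_of_le hcb.le] at hI
      refine lt_of_le_of_lt (setLIntegral_mono' measurableSet_Ioc fun t ht => ?_)
        hI.setLIntegral_lt_top
      refine ENNReal.ofReal_le_ofReal ?_
      rw [← Real.mul_rpow hm.le (abs_nonneg _), abs_of_pos (sub_pos.2 ht.1)]
      refine Real.rpow_le_rpow_of_nonpos (mul_pos hm (sub_pos.2 ht.1)) ?_ hexp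
      have := intervalIntegral.integral_mono_on (μ := volume) ht.1.le (by simp) (hfi c t)
        (fun s hs => neg_le_neg (hanti hc (hc.trans_le hs.1) hs.1))
      simpa [mul_comm] using this
    · refine lt_of_le_of_lt (setLIntegral_mono' measurableSet_Ioi fun t ht => ?_) h
      refine ENNReal.ofReal_le_ofReal (Real.rpow_le_rpow_of_nonpos (hpos t ht) ?_ hexp)
      rw [← intervalIntegral.integral_add_adjacent_intervals (hfi c b) (hfi b t)]
      have : 0 ≤ ∫ s in c..b, -f s := intervalIntegral.integral_nonneg hcb.le fun s hs => by
        have := hneg s (hc.trans_le hs.1)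
        linarith
      linarith

theorem hasDerivAt_max_zero_sq (s : ℝ) :
    HasDerivAt (fun s : ℝ => max s 0 ^ 2) (2 * max s 0) s := by
  have hc : Continuous fun s : ℝ => max s 0 := continuous_id.max continuous_const
  have hne : ∀ s : ℝ, s ≠ 0 → HasDerivAt (fun s : ℝ => max s 0 ^ 2) (2 * max s 0) s := by
    intro s hs
    rcases hs.lt_or_gt with hs | hs
    · rw [max_eq_right hs.le, mul_zero]
      refine (hasDerivAt_const s (0 : ℝ)).congr_of_eventuallyEq ?_
      filter_upwards [gt_mem_nhds hs] with y hy
      simp [max_eq_right (le_of_lt hy)]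
    · rw [max_eq_left hs.le]
      have h := hasDerivAt_pow 2 s
      norm_num at h
      refine h.congr_of_eventuallyEq ?_
      filter_upwards [lt_mem_nhds hs] with y hy
      rw [max_eq_left (le_of_lt hy)]
  rcases eq_or_ne s 0 with rfl | hs
  · exact hasDerivAt_of_hasDerivAt_of_ne (fun y hy => hne y hy) (hc.pow 2).continuousAt
      (continuous_const.mul hc).continuousAt
  · exact hne s hs

theorem contDiff_max_zero_sq : ContDiff ℝ 1 fun s : ℝ => max s 0 ^ 2 := by
  rw [contDiff_one_iff_deriv]
  refine ⟨fun s => (hasDerivAt_max_zero_sq s).differentiableAt, ?_⟩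
  rw [deriv_eq hasDerivAt_max_zero_sq]
  exact continuous_const.mul (continuous_id.max continuous_const)

/-! ### Weak comparison and the a priori upper bound -/

section Comparison

variable {N : ℕ} {p : ℝ}

/-- Weak comparison on a ball. If `u < w` on the sphere and the right-hand side of the
supersolution `w` exceeds that of the subsolution `u` by a fixed `δ > 0` wherever `w < u` in the
ball, then `u ≤ w` in the ball. -/
theorem le_of_weak_inequalities (hp : 1 < p) {u w : EuclideanSpace ℝ (Fin N) → ℝ}
    {F H : EuclideanSpace ℝ (Fin N) → ℝ} (hu : IsPSubsolution p F u)
    (hw : IsPSupersolution p H w) (hcu : Continuous F) (hcw : Continuous H)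
    {x₀ : EuclideanSpace ℝ (Fin N)} {R : ℝ} (hbd : ∀ x, ‖x - x₀‖ = R → u x < w x) {δ : ℝ}
    (hδ : 0 < δ) (hlt : ∀ x, ‖x - x₀‖ < R → w x < u x → F x + δ ≤ H x)
    {x : EuclideanSpace ℝ (Fin N)} (hx : ‖x - x₀‖ < R) : u x ≤ w x := by
  classical
  have hn : Continuous fun x : EuclideanSpace ℝ (Fin N) => ‖x - x₀‖ :=
    (continuous_id.sub continuous_const).norm
  have hDc : ContDiff ℝ 1 fun x => u x - w x := hu.1.sub hw.1
  -- Squaring the positive part makes the test function `C¹`. The strict inequality on the sphere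
  -- makes it vanish near the sphere, so its cut-off to the ball stays `C¹`.
  set ψ : EuclideanSpace ℝ (Fin N) → ℝ := fun x => max (u x - w x) 0 ^ 2 with hψ
  have hψc : ContDiff ℝ 1 ψ := contDiff_max_zero_sq.comp hDc
  set φ : EuclideanSpace ℝ (Fin N) → ℝ := fun x => if ‖x - x₀‖ < R then ψ x else 0 with hφ
  have hin : ∀ x, ‖x - x₀‖ < R → φ =ᶠ[𝓝 x] ψ := by
    intro x hx
    filter_upwards [hn.continuousAt.eventually_lt_const hx] with y hy
    simp [hφ, hy]
  have hout : ∀ x, R ≤ ‖x - x₀‖ → φ =ᶠ[𝓝 x] fun _ => 0 := by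
    intro x hx
    rcases hx.eq_or_lt with hx | hx
    · have h1 : ∀ᶠ y in 𝓝 x, u y < w y :=
        hu.1.continuous.continuousAt.eventually_lt hw.1.continuous.continuousAt (hbd x hx.symm)
      filter_upwards [h1] with y hy
      simp [hφ, hψ, max_eq_right (sub_neg.2 hy).le]
    · filter_upwards [hn.continuousAt.eventually_const_lt hx] with y hy
      simp [hφ, not_lt.2 (le_of_lt hy)]
  have hφc : ContDiff ℝ 1 φ := by
    refine contDiff_iff_contDiffAt.2 fun x => ?_
    rcases lt_or_ge ‖x - x₀‖ R with hx | hx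
    · exact hψc.contDiffAt.congr_of_eventuallyEq (hin x hx)
    · exact contDiffAt_const.congr_of_eventuallyEq (hout x hx)
  have hφs : HasCompactSupport φ := by
    refine HasCompactSupport.intro (isCompact_closedBall x₀ R) fun x hx => ?_
    rw [Metric.mem_closedBall, dist_eq_norm, not_le] at hx
    simp [hφ, not_lt.2 hx.le]
  have hφ0 : ∀ x, 0 ≤ φ x := by
    intro x
    simp only [hφ]
    split_ifs
    exacts [sq_nonneg _, le_rfl]
  have h1 := hu.2 φ hφc hφs hφ0
  have h2 := hw.2 φ hφc hφs hφ0
  have hgs : HasCompactSupport (gradient φ) := by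
    refine HasCompactSupport.intro (isCompact_closedBall x₀ R) fun x hx => ?_
    rw [Metric.mem_closedBall, dist_eq_norm, not_le] at hx
    rw [(hout x hx.le).gradient_eq, gradient_fun_const]
  have hint : ∀ v : EuclideanSpace ℝ (Fin N) → ℝ, ContDiff ℝ 1 v →
      Integrable fun x => ⟪pFlux p v x, gradient φ x⟫ := by
    intro v hv
    refine ((continuous_pFlux hp hv).inner (continuous_gradient hφc)).integrable_of_hasCompactSupport
      (hgs.mono fun x hx => ?_)
    rw [Function.mem_support] at hx ⊢
    contrapose! hx
    rw [hx, inner_zero_right]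
  have h3 : 0 ≤ ∫ x, (⟪pFlux p u x, gradient φ x⟫ - ⟪pFlux p w x, gradient φ x⟫) := by
    refine integral_nonneg fun x => ?_
    simp only [Pi.zero_apply]
    rw [← inner_sub_left]
    rcases lt_or_ge ‖x - x₀‖ R with hx | hx
    · have hd : HasFDerivAt ψ ((2 * max (u x - w x) 0) • (fderiv ℝ u x - fderiv ℝ w x)) x :=
        (hasDerivAt_max_zero_sq _).comp_hasFDerivAt x
          (((hu.1.differentiable one_ne_zero) x).hasFDerivAt.sub
            ((hw.1.differentiable one_ne_zero) x).hasFDerivAt)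
      rw [(hin x hx).gradient_eq, inner_gradient_right, hd.fderiv]
      simp only [smul_apply, sub_apply, smul_eq_mul,
        ← inner_gradient_left]
      rw [← inner_sub_left, real_inner_comm]
      exact mul_nonneg (by positivity) (inner_norm_rpow_smul_sub_nonneg hp _ _)
    · rw [(hout x hx).gradient_eq, gradient_fun_const, inner_zero_right]
  rw [integral_sub (hint u hu.1) (hint w hw.1)] at h3
  have hiφ : Integrable φ := hφc.continuous.integrable_of_hasCompactSupport hφs
  have hiu : Integrable fun x => F x * φ x :=
    (hcu.mul hφc.continuous).integrable_of_hasCompactSupport hφs.mul_left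
  have hiw : Integrable fun x => H x * φ x :=
    (hcw.mul hφc.continuous).integrable_of_hasCompactSupport hφs.mul_left
  -- Chaining `h2`, `h3` and `h1` gives `∫ H φ ≤ ∫ F φ`. The gap `δ` then forces `∫ φ ≤ 0`, so plain
  -- monotonicity of the flux suffices, without its strict form.
  have h4 : ∫ x, (F x * φ x + δ * φ x) ≤ ∫ x, H x * φ x := by
    refine integral_mono (hiu.add (hiφ.const_mul δ)) hiw fun x => ?_
    simp only
    rw [← add_mul]
    rcases lt_or_ge ‖x - x₀‖ R with hx | hx
    · rcases lt_or_ge (w x) (u x) with hx' | hx'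
      · exact mul_le_mul_of_nonneg_right (hlt x hx hx') (hφ0 x)
      · have : φ x = 0 := by simp [hφ, hψ, max_eq_right (sub_nonpos.2 hx')]
        simp [this]
    · simp [(hout x hx).eq_of_nhds]
  rw [integral_add hiu (hiφ.const_mul δ), integral_const_mul] at h4
  by_contra hcon
  rw [not_le] at hcon
  have hφx : φ x ≠ 0 := by
    simp only [hφ, hψ, hx, if_true]
    have : 0 < max (u x - w x) 0 := lt_max_of_lt_left (sub_pos.2 hcon)
    positivity
  have h5 := hφc.continuous.integral_pos_of_hasCompactSupport_nonneg_nonzero (μ := volume)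
    hφs hφ0 hφx
  have h6 := mul_pos hδ h5
  linarith

/-- Radial functions `W(|x - x₀|)` with `(W'^{p-1})' = F` are weak supersolutions. -/
theorem isPSupersolution_radial (hN : 0 < N) (hp : 1 < p) {W W' F : ℝ → ℝ}
    (hW : ∀ r, HasDerivAt W (W' r) r) (hc : Continuous W') (h0 : W' 0 = 0)
    (hn : ∀ r, 0 ≤ r → 0 ≤ W' r ∧ W' r ^ (p - 1) = ∫ s in (0 : ℝ)..r, F s)
    (hF : Continuous F) (hmono : Monotone F) {C : ℝ} (hF0 : ∀ r, 0 ≤ F r) (hFC : ∀ r, F r ≤ C)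
    (x₀ : EuclideanSpace ℝ (Fin N)) :
    IsPSupersolution p (fun x => -(N * F ‖x - x₀‖)) fun x => W ‖x - x₀‖ := by
  refine ⟨contDiff_radial hW hc h0 x₀, fun φ hφ hφc hφ0 => ?_⟩
  have h := neg_integral_le_integral_radial_field hN hF hmono hF0 hFC x₀ hφ hφc hφ0
  simp only [pFlux_radial hp hW h0 (fun r hr => (hn r hr).1), (hn _ (norm_nonneg _)).2, neg_mul,
    integral_neg]
  exact h

/-- The integral is the radius at which a profile starting from `c` reaches height `M`; the point is
that `R` is uniform in `M`. -/
theorem KellerOssermanAtTop.exists_bound {f : ℝ → ℝ} (hf : Continuous f) {c : ℝ}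
    (h : KellerOssermanAtTop p f c) (hpos : ∀ t, c ≤ t → f t ≤ 0) {a : ℝ} (ha : 0 ≤ a) :
    ∃ R : ℝ, 0 < R ∧ ∀ M, c ≤ M → ∫ x in c..M, (a * ∫ s in c..x, -f s) ^ (-(1 / p)) ≤ R := by
  set Φ : ℝ → ℝ := fun x => (∫ s in c..x, -f s) ^ (-(1 / p)) with hΦ
  have hG : ∀ x, c ≤ x → 0 ≤ ∫ s in c..x, -f s := fun x hx =>
    intervalIntegral.integral_nonneg hx fun s hs => by
      have := hpos s hs.1
      linarith
  have hΦm : Measurable Φ := by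
    have : Continuous fun x => ∫ s in c..x, -f s :=
      intervalIntegral.continuous_primitive (fun x y => hf.neg.intervalIntegrable x y) c
    exact this.measurable.pow_const _
  -- The added `1` only ensures `0 < R`.
  refine ⟨a ^ (-(1 / p)) * (∫⁻ t in Ioi c, ENNReal.ofReal (Φ t)).toReal + 1, by positivity,
    fun M hM => ?_⟩
  have e : ∫ x in c..M, (a * ∫ s in c..x, -f s) ^ (-(1 / p)) =
      a ^ (-(1 / p)) * ∫ x in c..M, Φ x := by
    rw [← intervalIntegral.integral_const_mul]
    refine intervalIntegral.integral_congr fun x hx => ?_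
    rw [uIcc_of_le hM] at hx
    simp only [hΦ]
    rw [Real.mul_rpow ha (hG x hx.1)]
  have h1 : ∫ x in c..M, Φ x ≤ (∫⁻ t in Ioi c, ENNReal.ofReal (Φ t)).toReal := by
    rw [intervalIntegral.integral_of_le hM, integral_eq_lintegral_of_nonneg_ae]
    · exact ENNReal.toReal_mono h.ne (lintegral_mono_set Ioc_subset_Ioi_self)
    · filter_upwards [ae_restrict_mem measurableSet_Ioc] with x hx
      exact Real.rpow_nonneg (hG x hx.1.le) _
    · exact hΦm.aestronglyMeasurable
  rw [e]
  have := mul_le_mul_of_nonneg_left h1 (Real.rpow_nonneg ha (-(1 / p)))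
  linarith

/-- A priori bound: under the Keller–Osserman condition, entire subsolutions lie below the
threshold `β` beyond which `f` is negative. -/
theorem IsPSubsolution.le_of_kellerOsserman (hN : 0 < N) (hp : 1 < p) {f : ℝ → ℝ}
    (hf : Continuous f) {β b : ℝ} (hneg : ∀ t, β < t → f t < 0) (hanti : AntitoneOn f (Ioi β))
    (hb : β ≤ b) (hKO : KellerOssermanAtTop p f b) {u : EuclideanSpace ℝ (Fin N) → ℝ}
    (hu : IsPSubsolution p (fun x => f (u x)) u) (x₀ : EuclideanSpace ℝ (Fin N)) : u x₀ ≤ β := by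
  refine le_of_forall_gt_imp_ge_of_dense fun c hc => ?_
  have hN' : (0 : ℝ) < N := by exact_mod_cast hN
  have hp1 : 0 < p - 1 := by linarith
  have hp0 : 0 < p := by linarith
  -- The factor `1/N` offsets the divergence bound `N F`; the factor `1/2` leaves the strict gap
  -- needed for comparison.
  set κ : ℝ := 1 / (2 * N) with hκ
  have hκ0 : 0 < κ := by positivity
  obtain ⟨R, hR, hRb⟩ := (hKO.of_lt hp hf hneg hanti hb hc).exists_bound hf
    (fun t ht => (hneg t (hc.trans_le ht)).le) (show 0 ≤ p / (p - 1) * κ by positivity)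
  obtain ⟨M₀, hM₀⟩ := (isCompact_closedBall x₀ R).exists_bound_of_continuousOn
    hu.1.continuous.continuousOn
  -- `M` is chosen after `R`, strictly above `u` on the closed ball.
  set M : ℝ := max (M₀ + 1) c with hM
  have hcM : c ≤ M := le_max_right _ _
  have huM : ∀ x, ‖x - x₀‖ ≤ R → u x < M := by
    intro x hx
    have h1 := hM₀ x (by rwa [Metric.mem_closedBall, dist_eq_norm])
    have h2 : M₀ + 1 ≤ M := le_max_left _ _
    have h3 := le_abs_self (u x)
    rw [Real.norm_eq_abs] at h1
    linarith
  -- Clamping keeps `g` between `-f c > 0` and `-f M`, as the global profile requires, without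
  -- changing it on `[c, M]`, which contains the values of `u` wherever the barrier lies below `u`.
  set g : ℝ → ℝ := fun t => -f (max c (min t M)) with hg
  have hclamp : ∀ t, c ≤ t → t ≤ M → g t = -f t := fun t h1 h2 => by
    simp [hg, min_eq_left h2, max_eq_right h1]
  have hgc : Continuous g :=
    (hf.comp (continuous_const.max (continuous_id.min continuous_const))).neg
  have hmem : ∀ t, β < max c (min t M) := fun t => hc.trans_le (le_max_left _ _)
  have hgmono : Monotone g := fun s t hst => neg_le_neg
    (hanti (hmem s) (hmem t) (max_le_max le_rfl (min_le_min hst le_rfl)))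
  have hm : 0 < -f c := by have := hneg c hc; linarith
  have hgm : ∀ t, -f c ≤ g t := fun t => neg_le_neg (hanti hc (hmem t) (le_max_left _ _))
  have hgC : ∀ t, g t ≤ -f M := fun t =>
    neg_le_neg (hanti (hmem t) (hc.trans_le hcM) (max_le hcM (min_le_right _ _)))
  obtain ⟨W, W', hWm, hW0, hWc, hW'0, hWd, hWp, hWt⟩ :=
    exists_radial_profile hp hκ0 hgc hm hgm hgC c
  have hWcont : Continuous W := continuous_iff_continuousAt.2 fun t => (hWd t).continuousAt
  -- The profile takes the value `M` at a radius given by the truncated Keller–Osserman integral,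
  -- hence at most `R`.
  have hWR : M ≤ W R := by
    have h1 := hWt M hcM
    rw [← h1]
    refine hWm.monotone (le_trans (le_of_eq ?_) (hRb M hcM))
    refine intervalIntegral.integral_congr fun x hx => ?_
    rw [uIcc_of_le hcM] at hx
    congr 2
    refine intervalIntegral.integral_congr fun s hs => ?_
    rw [uIcc_of_le hx.1] at hs
    exact hclamp s hs.1 (hs.2.trans hx.2)
  have hw := isPSupersolution_radial hN hp hWd hWc hW'0 hWp
    (continuous_const.mul (hgc.comp hWcont))
    (fun s t hst => mul_le_mul_of_nonneg_left (hgmono (hWm.monotone hst)) hκ0.le)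
    (C := κ * -f M) (fun r => mul_nonneg hκ0.le (hm.le.trans (hgm _)))
    (fun r => mul_le_mul_of_nonneg_left (hgC _) hκ0.le) x₀
  have h := le_of_weak_inequalities hp hu hw (hf.comp hu.1.continuous)
    (continuous_const.mul (continuous_const.mul ((hgc.comp hWcont).comp
      (continuous_id.sub continuous_const).norm))).neg (x₀ := x₀) (R := R)
    (fun x hx => by rw [hx]; exact (huM x hx.le).trans_le hWR) (half_pos hm)
    (fun x hx hlt => ?_) (x := x₀) (by simpa using hR)
  · simpa [hW0] using h
  · have hcw : c ≤ W ‖x - x₀‖ := by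
      rw [← hW0]
      exact hWm.monotone (norm_nonneg _)
    have h1 : g (W ‖x - x₀‖) ≤ -f (u x) := by
      rw [← hclamp (u x) (hcw.trans hlt.le) (huM x hx.le).le]
      exact hgmono hlt.le
    have h2 := hgm (W ‖x - x₀‖)
    have h3 : (N : ℝ) * (κ * g (W ‖x - x₀‖)) = g (W ‖x - x₀‖) / 2 := by
      rw [hκ]
      field_simp
    rw [h3]
    linarith

end Comparison

/-! ### Reflection and conclusion -/

/-- Reflection `t ↦ -t` exchanges the two Keller–Osserman conditions. -/
theorem KellerOssermanAtBot.neg {p : ℝ} {f : ℝ → ℝ} {a : ℝ} (h : KellerOssermanAtBot p f a) :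
    KellerOssermanAtTop p (fun t => -f (-t)) (-a) := by
  unfold KellerOssermanAtTop
  unfold KellerOssermanAtBot at h
  have h1 := (Measure.measurePreserving_neg (volume : Measure ℝ)).setLIntegral_comp_emb
    (MeasurableEquiv.neg ℝ).measurableEmbedding
    (fun t => ENNReal.ofReal ((∫ s in t..a, f s) ^ (-(1 / p)))) (Ioi (-a))
  rw [image_neg_Ioi, neg_neg] at h1
  rw [← h1] at h
  refine lt_of_le_of_lt (le_of_eq ?_) h
  refine lintegral_congr fun t => ?_
  simp only [neg_neg]
  rw [intervalIntegral.integral_comp_neg f, neg_neg]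

theorem IsPSupersolution.neg {N : ℕ} {p : ℝ} {h u : EuclideanSpace ℝ (Fin N) → ℝ}
    (hu : IsPSupersolution p h u) : IsPSubsolution p (fun x => -h x) fun x => -u x := by
  refine ⟨hu.1.neg, fun φ hφ hφc hφ0 => ?_⟩
  have := hu.2 φ hφ hφc hφ0
  simp only [pFlux_neg, inner_neg_left, neg_mul, integral_neg]
  linarith

theorem mainTheorem4 (N : ℕ) (hN : 1 < N) (p : ℝ) (hp : 1 < p)
    (f : ℝ → ℝ) (hf : Continuous f) (α β : ℝ) (hαβ : α ≤ β)
    (hpos : ∀ t, t < α → 0 < f t) (hanti_left : AntitoneOn f (Iio α))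
    (hneg : ∀ t, β < t → f t < 0) (hanti_right : AntitoneOn f (Ioi β))
    (a b : ℝ) (ha : a ≤ α) (hb : β ≤ b)
    (hKO_left : KellerOssermanAtBot p f a) (hKO_right : KellerOssermanAtTop p f b)
    (u : EuclideanSpace ℝ (Fin N) → ℝ) (hu : IsPSolution p f u) :
    Bornology.IsBounded (range u) ∧ ∀ x, α ≤ u x ∧ u x ≤ β := by
  have hN0 : 0 < N := by omega
  have hle : ∀ x, u x ≤ β := fun x =>
    hu.2.le_of_kellerOsserman hN0 hp hf hneg hanti_right hb hKO_right x
  have hsub : IsPSubsolution p (fun x => (fun t => -f (-t)) (-u x)) fun x => -u x := by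
    simpa only [neg_neg] using hu.1.neg
  have hge : ∀ x, α ≤ u x := by
    intro x
    -- The upper bound for `-u`, with threshold `-α` and base point `-a`.
    have h := hsub.le_of_kellerOsserman hN0 hp (f := fun t => -f (-t)) (β := -α)
      (hf.comp continuous_neg).neg
      (fun t ht => neg_neg_of_pos (hpos (-t) (by linarith)))
      (fun s hs t ht hst => neg_le_neg (hanti_left (show -t < α from neg_lt.1 ht)
        (show -s < α from neg_lt.1 hs) (neg_le_neg hst)))
      (neg_le_neg ha) hKO_left.neg x
    exact neg_le_neg_iff.1 h
  refine ⟨(Metric.isBounded_Icc α β).subset ?_, fun x => ⟨hge x, hle x⟩⟩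
  rintro _ ⟨x, rfl⟩
  exact ⟨hge x, hle x⟩
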